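/- Let $\Gamma=(V,E)$ be a finite metric graph with at least one edge: every edge $e\in E$ is an interval $[0,\ell_e]$ with $0<\ell_e<\infty$, and the vertices are the classes of a partition of the set of all edge endpoints (loops, multiple edges and disconnected graphs are allowed). Put $L=\sum_{e\in E}\ell_e$ and $\ell_{\max}=\max_{e\in E}\ell_e$. Let $p\in[1,\infty]$ (with $1/\infty=0$), let $q\in L^p(\Gamma)$ be real-valued, $q_+=\max(q,0)$, and let $\alpha_v\in\mathbb R\cup\{\infty\}$ for $v\in V$ be arbitrary. A real number $\lambda$ is called an eigenvalue of the Schrödinger operator $H_q$ with coupling strengths $(\alpha_v)$ if there is a real function $f\not\equiv 0$, continuous on $\Gamma$, such that on each edge $f$ is continuously differentiable, $f'$ is absolutely continuous and $-f''+qf=\lambda f$ almost everywhere, and such that at each vertex $v$ $$\sum_{e} f_e'(v)=\alpha_v f(v)\quad\text{if }\alpha_v\in\mathbb R,\qquad f(v)=0\quad\text{if }\alpha_v=\infty;$$ the sum runs over all edge ends at $v$ (a loop contributes both of its ends), and derivatives are taken in the direction pointing out of $v$ into the edge. Then $H_q$ has a smallest eigenvalue $\lambda_1(H_q)$, and $$\lambda_1(H_q)\le\left(\frac{2}{\ell_{\max}}\right)^{1/p}\|q_+\|_{L^p(\Gamma)}+\left(\frac{\pi}{\ell_{\max}}\right)^2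 .$$ Moreover, $$\lambda_1(H_q)\le\left(\frac{2|E|}{L}\right)^{1/p}\|q_+\|_{L^p(\Gamma)}+\left(\frac{\pi|E|}{L}\right)^2 .$$ -/

import Mathlib

open MeasureTheory Set
open scoped ENNReal

/-- A metric graph with edge set `E` and vertex set `V`: each edge `e` is an interval
`[0, len e]` of positive length; its endpoint `0` is glued to the vertex `src e` and its endpoint
`len e` to the vertex `tgt e`. Loops, multiple edges and disconnected graphs are allowed.
The vertices are the (nonempty) classes of a partition of the set of endpoints of edges,
so every vertex is an endpoint of some edge. -/
structure MetricGraph (V E : Type*) where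
  len : E → ℝ
  len_pos : ∀ e, 0 < len e
  src : E → V
  tgt : E → V
  incident : ∀ v, ∃ e, src e = v ∨ tgt e = v

namespace MetricGraph

variable {V E : Type*}

/-- Lebesgue measure on the disjoint union of the edges `[0, len e]`
(gluing the finitely many endpoints does not affect it). -/
noncomputable def measure (Γ : MetricGraph V E) : Measure (Σ _ : E, ℝ) :=
  Measure.sum fun e => (volume.restrict (Icc 0 (Γ.len e))).map (Sigma.mk e)

/-- The total length `L(Γ)`. -/
noncomputable def totalLength [Fintype E] (Γ : MetricGraph V E) : ℝ :=
  ∑ e, Γ.len e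

/-- The length `ℓ_max` of the longest edge. -/
noncomputable def maxLength (Γ : MetricGraph V E) : ℝ :=
  ⨆ e, Γ.len e

/-- The sum over all edge ends at `v` of the derivatives at `v`, taken in the direction pointing
out of `v` into the edge, where `f' e` is the derivative along `[0, len e]`.
A loop at `v` contributes both of its ends. -/
noncomputable def outwardDerivSum [Fintype E] [DecidableEq V] (Γ : MetricGraph V E)
    (f' : E → ℝ → ℝ) (v : V) : ℝ :=
  ∑ e, ((if Γ.src e = v then f' e 0 else 0) + (if Γ.tgt e = v then -f' e (Γ.len e) else 0))

/-- The function on `Γ` given by the edge functions `f e` on `[0, len e]`, with derivative `f'`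
and vertex values `u`, is an eigenfunction with eigenvalue `lam` of the Schrödinger operator
`H_q = -d²/dx² + q` with `δ`-couplings `α`; the value `α v = ⊤` means the Dirichlet condition. -/
structure IsEigenfunction [Fintype E] [DecidableEq V] (Γ : MetricGraph V E)
    (q : E → ℝ → ℝ) (α : V → WithTop ℝ) (lam : ℝ) (f f' : E → ℝ → ℝ) (u : V → ℝ) : Prop where
  nonzero : ∃ e, ∃ x ∈ Icc 0 (Γ.len e), f e x ≠ 0
  /-- continuity at the vertices -/
  eq_src : ∀ e, f e 0 = u (Γ.src e)
  eq_tgt : ∀ e, f e (Γ.len e) = u (Γ.tgt e)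
  /-- on each edge `f` is differentiable, with an absolutely continuous derivative -/
  hasDeriv : ∀ e, ∀ x ∈ Icc 0 (Γ.len e), HasDerivWithinAt (f e) (f' e x) (Icc 0 (Γ.len e)) x
  absCont : ∀ e, AbsolutelyContinuousOnInterval (f' e) 0 (Γ.len e)
  /-- `-f'' + q f = lam f` almost everywhere -/
  eqn : ∀ e, ∀ᵐ x ∂(volume.restrict (Icc 0 (Γ.len e))),
    ∃ f'' : ℝ, HasDerivAt (f' e) f'' x ∧ -f'' + q e x * f e x = lam * f e x
  /-- `δ`-coupling of real strength `a` -/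
  coupling : ∀ v, ∀ a : ℝ, α v = (a : WithTop ℝ) → Γ.outwardDerivSum f' v = a * u v
  /-- coupling of strength `∞` -/
  dirichlet : ∀ v, α v = ⊤ → u v = 0

/-- The set of eigenvalues of `H_q` with couplings `α`. -/
def eigenvalues [Fintype E] [DecidableEq V] (Γ : MetricGraph V E)
    (q : E → ℝ → ℝ) (α : V → WithTop ℝ) : Set ℝ :=
  {lam | ∃ f f' u, Γ.IsEigenfunction q α lam f f' u}

/-- The principal eigenvalue `λ₁(H_q)`, i.e. the smallest eigenvalue
(the infimum is a minimum; this is asserted where the definition is used). -/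
noncomputable def principalEigenvalue [Fintype E] [DecidableEq V] (Γ : MetricGraph V E)
    (q : E → ℝ → ℝ) (α : V → WithTop ℝ) : ℝ :=
  sInf (Γ.eigenvalues q α)

/-- `‖q₊‖_{L^p(Γ)}`, where `q₊ = max(q, 0)`. -/
noncomputable def posPartNorm (Γ : MetricGraph V E) (q : E → ℝ → ℝ) (p : ℝ≥0∞) : ℝ :=
  (eLpNorm (fun x : (Σ _ : E, ℝ) => max (q x.1 x.2) 0) p Γ.measure).toReal

end MetricGraph

/-! The bounds come from a single trial function. On an edge of length l take sin(πx/l) and extend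
it by zero. It vanishes at every vertex, so it is admissible for all couplings, and they contribute
nothing to its energy. Its Rayleigh quotient is (π/l)² plus the mean of q against the density (2/l)
sin²(πx/l). This density has total mass one and is at most 2/l, so the monotonicity of L^p norms on
a probability space bounds the mean by (2/l)^(1/p) ‖q₊‖_p (`integral_mul_sin_sq_le`). The longest
edge gives the first estimate, and ℓ_max ≥ L/|E| gives the second.

Most of the work is to show that the minimum of the Rayleigh quotient exists and is the smallest
eigenvalue. A function is encoded by its vertex values and its L² derivatives on the edges. By
Arzelà–Ascoli the form domain embeds compactly into the continuous functions, and the sup norm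
controls both the potential, which need only be L¹, and the couplings (`energyForm_garding`). The
direct method (`exists_smallest_eigenvalue_of_isCompactOperator`) yields a minimizer that solves the
weak equation. A du Bois-Reymond argument and Green's formula turn it into an eigenfunction
(`isEigenfunction_of_weak`). Conversely, every eigenvalue is the Rayleigh quotient of its
eigenfunction (`exists_energyForm_eq_of_mem_eigenvalues`), so none lies below the minimum. -/

/-! ### Abstract direct method. -/

open Filter Topology in
/-- Direct method: a symmetric form that is coercive modulo a compact map attains its
smallest generalized eigenvalue. -/
theorem exists_smallest_eigenvalue_of_isCompactOperator {X C : Type*}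
    [NormedAddCommGroup X] [NormedSpace ℝ X] [CompleteSpace X]
    [NormedAddCommGroup C] [NormedSpace ℝ C] (J : X →L[ℝ] C) (hJ : IsCompactOperator J)
    (Q : LinearMap.BilinForm ℝ X) (hQ : ∀ x y, Q x y = Q y x) (hQc : Continuous fun x => Q x x)
    (n : LinearMap.BilinForm ℝ C) (hn : ∀ x y, n x y = n y x) (hnc : Continuous fun c => n c c)
    (hpos : ∀ c, c ≠ 0 → 0 < n c c) {K M : ℝ} (hK : 0 < K)
    (hG : ∀ x, K * ‖x‖ ^ 2 ≤ Q x x + M * ‖J x‖ ^ 2) (hne : ∃ x, J x ≠ 0) :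
    ∃ (lam : ℝ) (x : X), J x ≠ 0 ∧ (∀ y, Q x y = lam * n (J x) (J y)) ∧
      ∀ y, lam * n (J y) (J y) ≤ Q y y := by
  have hn0 : ∀ c, 0 ≤ n c c := fun c => by
    rcases eq_or_ne c 0 with rfl | h
    · simp
    · exact (hpos c h).le
  have hsub : ∀ x : ℕ → X, (∀ i, ‖x i‖ = 1) →
      ∃ (c : C) (φ : ℕ → ℕ), StrictMono φ ∧ Tendsto (fun i => J (x (φ i))) atTop (𝓝 c) := by
    intro x hx
    obtain ⟨S, hS, hsubS⟩ :=
      (isCompactOperator_iff_image_closedBall_subset_compact J.toLinearMap one_pos).1 hJ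
    obtain ⟨c, -, φ, hφ, hc⟩ := hS.tendsto_subseq (x := fun i => J (x i))
      (fun i => hsubS ⟨x i, by simp [hx i], rfl⟩)
    exact ⟨c, φ, hφ, hc⟩
  have hnorm : ∀ μ : ℝ, (∃ x, Q x x < μ * n (J x) (J x)) →
      ∃ x, ‖x‖ = 1 ∧ Q x x < μ * n (J x) (J x) := by
    rintro μ ⟨x, hx⟩
    have hx0 : x ≠ 0 := by rintro rfl; simp at hx
    have h1 : 0 < ‖x‖ := norm_pos_iff.2 hx0
    refine ⟨‖x‖⁻¹ • x, by simp [norm_smul, h1.ne'], ?_⟩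
    simp only [map_smul, LinearMap.smul_apply, smul_eq_mul]
    have h2 : 0 < ‖x‖⁻¹ * ‖x‖⁻¹ := by positivity
    nlinarith [mul_lt_mul_of_pos_left hx h2]
  -- the form is bounded below
  have hbdd : ∃ μ : ℝ, ∀ x, μ * n (J x) (J x) ≤ Q x x := by
    by_contra! hcon
    choose x hx1 hx using fun i : ℕ => hnorm (-(i : ℝ)) (hcon _)
    obtain ⟨c, φ, hφ, hc⟩ := hsub x hx1
    have hnl : Tendsto (fun i => n (J (x (φ i))) (J (x (φ i)))) atTop (𝓝 (n c c)) :=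
      (hnc.tendsto c).comp hc
    have hJl : Tendsto (fun i => M * ‖J (x (φ i))‖ ^ 2) atTop (𝓝 (M * ‖c‖ ^ 2)) :=
      (hc.norm.pow 2).const_mul M
    -- If c ≠ 0, then φ i · n(Jx, Jx) tends to infinity, although coercivity bounds it by M‖Jx‖².
    -- Once c = 0, the same inequality forces K ≤ 0 in the limit.
    have hc0 : c = 0 := by
      by_contra hc0
      have h1 : Tendsto (fun i => (φ i : ℝ) * n (J (x (φ i))) (J (x (φ i)))) atTop atTop :=
        ((tendsto_natCast_atTop_atTop (R := ℝ)).comp hφ.tendsto_atTop).atTop_mul_pos (hpos c hc0) hnl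
      refine not_tendsto_nhds_of_tendsto_atTop (tendsto_atTop_mono (fun i => ?_) h1) _ hJl
      have := hG (x (φ i)); have := hx (φ i)
      rw [hx1] at *
      linarith
    subst hc0
    have h2 : K ≤ M * ‖(0 : C)‖ ^ 2 := ge_of_tendsto' hJl fun i => by
      have h3 := hG (x (φ i)); have h4 := hx (φ i)
      have h5 := mul_nonneg (φ i).cast_nonneg (α := ℝ) (hn0 (J (x (φ i))))
      rw [hx1] at h3
      linarith
    simp at h2
    linarith
  obtain ⟨x₀, hx₀⟩ := hne
  -- The supremum of S is the infimum of the Rayleigh quotient, expressed without dividing by n,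
  -- which vanishes on the kernel of J.
  set S : Set ℝ := {μ | ∀ x, μ * n (J x) (J x) ≤ Q x x} with hS
  have hSb : BddAbove S := ⟨Q x₀ x₀ / n (J x₀) (J x₀), fun μ hμ =>
    (le_div_iff₀ (hpos _ hx₀)).2 (hμ x₀)⟩
  have hSne : S.Nonempty := hbdd
  set lam := sSup S with hlam
  have hle : ∀ y, lam * n (J y) (J y) ≤ Q y y := by
    intro y
    rcases eq_or_ne (J y) 0 with h | h
    · obtain ⟨μ, hμ⟩ := hSne
      simpa [h] using hμ y
    · rw [← le_div_iff₀ (hpos _ h)]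
      exact csSup_le hSne fun μ hμ => (le_div_iff₀ (hpos _ h)).2 (hμ y)
  have hex : ∀ i : ℕ, ∃ x, ‖x‖ = 1 ∧ Q x x < (lam + 1 / ((i : ℝ) + 1)) * n (J x) (J x) := by
    intro i
    apply hnorm
    by_contra! hcon
    have h1 : lam + 1 / ((i : ℝ) + 1) ≤ lam := le_csSup hSb hcon
    have : 0 < 1 / ((i : ℝ) + 1) := by positivity
    linarith
  choose x hx1 hx using hex
  obtain ⟨c, φ, hφ, hc⟩ := hsub x hx1
  set z : ℕ → X := fun i => x (φ i) with hz
  set R : X → ℝ := fun y => Q y y - lam * n (J y) (J y) with hR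
  have hR0 : ∀ y, 0 ≤ R y := fun y => sub_nonneg.2 (hle y)
  have hRc : Continuous R := hQc.sub (continuous_const.mul (hnc.comp J.continuous))
  -- The parallelogram identity with the nonnegative term R (y + w) dropped.
  have hpar : ∀ y w, R (y - w) ≤ 2 * R y + 2 * R w := by
    intro y w
    have h1 := hR0 (y + w)
    simp only [hR, map_sub, map_add, LinearMap.sub_apply, LinearMap.add_apply] at h1 ⊢
    linarith
  have hRz : Tendsto (fun i => R (z i)) atTop (𝓝 0) := by
    have h1 : Tendsto (fun i => 1 / ((φ i : ℝ) + 1) * n (J (z i)) (J (z i))) atTop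
        (𝓝 (0 * n c c)) :=
      (tendsto_one_div_add_atTop_nhds_zero_nat.comp hφ.tendsto_atTop).mul ((hnc.tendsto c).comp hc)
    rw [zero_mul] at h1
    refine squeeze_zero (fun i => hR0 _) (fun i => ?_) h1
    have := hx (φ i)
    simp only [hR, hz]
    linarith
  -- R is small on differences by `hpar`, and the J-images are Cauchy. Coercivity then gives strong
  -- convergence of the minimizing sequence, with no recourse to weak compactness.
  have hcau : CauchySeq z := by
    have hzero : Tendsto (fun p : ℕ × ℕ => J (z p.1) - J (z p.2)) atTop (𝓝 0) := by
      rw [← prod_atTop_atTop_eq, ← sub_self c]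
      exact (hc.comp tendsto_fst).sub (hc.comp tendsto_snd)
    have hbig : Tendsto (fun p : ℕ × ℕ => (2 * R (z p.1) + 2 * R (z p.2) +
        lam * n (J (z p.1) - J (z p.2)) (J (z p.1) - J (z p.2)) +
        M * ‖J (z p.1) - J (z p.2)‖ ^ 2) / K) atTop (𝓝 0) := by
      have h1 : Tendsto (fun p : ℕ × ℕ => R (z p.1)) atTop (𝓝 0) := by
        rw [← prod_atTop_atTop_eq]; exact hRz.comp tendsto_fst
      have h2 : Tendsto (fun p : ℕ × ℕ => R (z p.2)) atTop (𝓝 0) := by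
        rw [← prod_atTop_atTop_eq]; exact hRz.comp tendsto_snd
      have h3 := (hnc.tendsto 0).comp hzero
      have := ((((h1.const_mul 2).add (h2.const_mul 2)).add (h3.const_mul lam)).add
        ((hzero.norm.pow 2).const_mul M)).div_const K
      simpa using this
    have hsq : Tendsto (fun p : ℕ × ℕ => ‖z p.1 - z p.2‖ ^ 2) atTop (𝓝 0) := by
      refine squeeze_zero (fun _ => by positivity) (fun p => ?_) hbig
      rw [le_div_iff₀ hK]
      have h1 := hG (z p.1 - z p.2)
      have h2 := hpar (z p.1) (z p.2)
      have h3 : R (z p.1 - z p.2) = Q (z p.1 - z p.2) (z p.1 - z p.2) -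
        lam * n (J (z p.1 - z p.2)) (J (z p.1 - z p.2)) := rfl
      rw [map_sub J] at h1 h3
      linarith
    rw [cauchySeq_iff_tendsto_dist_atTop_0]
    have h4 := hsq.sqrt
    simpa [dist_eq_norm, Real.sqrt_sq] using h4
  obtain ⟨y, hy⟩ := cauchySeq_tendsto_of_complete hcau
  have hy1 : ‖y‖ = 1 := tendsto_nhds_unique hy.norm (by simp [hz, hx1])
  have hRy : R y = 0 := tendsto_nhds_unique ((hRc.tendsto y).comp hy) hRz
  have hJy : J y ≠ 0 := by
    intro h
    have h1 := hG y
    simp only [hR, h] at hRy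
    simp [hy1, h] at h1 hRy
    linarith
  refine ⟨lam, y, hJy, fun w => ?_, hle⟩
  set b := Q y w - lam * n (J y) (J w) with hb
  -- Euler–Lagrange equation: t ↦ R (y + t w) is a nonnegative quadratic with zero constant term, so
  -- its discriminant forces b = 0.
  have hquad : ∀ t : ℝ, 0 ≤ R w * (t * t) + (2 * b) * t + 0 := by
    intro t
    have h1 := hR0 (y + t • w)
    have h2 : R (y + t • w) = R w * (t * t) + (2 * b) * t + R y := by
      simp only [hR, hb, map_add, map_smul, LinearMap.add_apply, LinearMap.smul_apply, smul_eq_mul,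
        hQ w y, hn (J w) (J y)]
      ring
    rw [h2, hRy] at h1
    exact h1
  have hd := discrim_le_zero hquad
  have hb0 : b = 0 := by
    unfold discrim at hd
    nlinarith [sq_nonneg b]
  linarith

/-! ### Antiderivatives of L² functions on an interval. -/

/-- Square integrable functions on `(0, l]`. -/
abbrev IntervalL2 (l : ℝ) : Type := Lp ℝ 2 (volume.restrict (Ioc (0 : ℝ) l))

namespace IntervalL2

variable {l : ℝ}

theorem integrable (g : IntervalL2 l) : Integrable g (volume.restrict (Ioc 0 l)) :=
  (Lp.memLp g).integrable one_le_two

theorem intervalIntegrable (g : IntervalL2 l) {x y : ℝ} (hx : x ∈ Icc 0 l) (hy : y ∈ Icc 0 l) :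
    IntervalIntegrable g volume x y := by
  rw [intervalIntegrable_iff]
  refine IntegrableOn.mono_set (t := Ioc 0 l) g.integrable ?_
  exact Ioc_subset_Ioc (le_min hx.1 hy.1) (max_le hx.2 hy.2)

theorem intervalIntegral_eq_inner (g : IntervalL2 l) {x y : ℝ} (hx : 0 ≤ x) (hxy : x ≤ y)
    (hy : y ≤ l) :
    ∫ t in x..y, g t = inner ℝ (indicatorConstLp 2 (μ := volume.restrict (Ioc (0 : ℝ) l))
      (measurableSet_Ioc (a := x) (b := y)) (by finiteness) (1 : ℝ)) g := by
  rw [L2.inner_indicatorConstLp_one, intervalIntegral.integral_of_le hxy,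
    Measure.restrict_restrict measurableSet_Ioc, inter_eq_left.2 (Ioc_subset_Ioc hx hy)]

/-- Cauchy–Schwarz against an indicator. This Hölder-1/2 estimate supplies both the boundedness and
the equicontinuity of antiderivatives. -/
theorem norm_intervalIntegral_le (g : IntervalL2 l) {x y : ℝ} (hx : x ∈ Icc 0 l)
    (hy : y ∈ Icc 0 l) : ‖∫ t in x..y, g t‖ ≤ √(dist x y) * ‖g‖ := by
  wlog hxy : x ≤ y generalizing x y
  · rw [intervalIntegral.integral_symm, norm_neg, dist_comm]
    exact this hy hx (le_of_not_ge hxy)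
  rw [g.intervalIntegral_eq_inner hx.1 hxy hy.2]
  refine (norm_inner_le_norm _ _).trans ?_
  gcongr
  rw [norm_indicatorConstLp (by simp) (by simp), measureReal_restrict_apply measurableSet_Ioc,
    inter_eq_left.2 (Ioc_subset_Ioc hx.1 hy.2), Real.volume_real_Ioc_of_le hxy, dist_comm,
    Real.dist_eq, abs_of_nonneg (sub_nonneg.2 hxy), Real.sqrt_eq_rpow]
  simp

theorem intervalIntegral_add (g h : IntervalL2 l) {x : ℝ} (hx : x ∈ Icc 0 l) :
    ∫ t in 0..x, (g + h) t = (∫ t in 0..x, g t) + ∫ t in 0..x, h t := by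
  simp only [intervalIntegral_eq_inner _ le_rfl hx.1 hx.2, inner_add_right]

theorem intervalIntegral_smul (c : ℝ) (g : IntervalL2 l) {x : ℝ} (hx : x ∈ Icc 0 l) :
    ∫ t in 0..x, (c • g) t = c * ∫ t in 0..x, g t := by
  simp only [intervalIntegral_eq_inner _ le_rfl hx.1 hx.2, inner_smul_right]

theorem inner_eq_intervalIntegral (hl : 0 ≤ l) (g h : IntervalL2 l) :
    inner ℝ g h = ∫ t in 0..l, g t * h t := by
  rw [L2.inner_def, intervalIntegral.integral_of_le hl]
  simp [mul_comm]

theorem intervalIntegral_congr_ae {f g : ℝ → ℝ} (h : f =ᵐ[volume.restrict (Ioc 0 l)] g) {x : ℝ}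
    (hx : x ∈ Icc 0 l) : ∫ t in 0..x, f t = ∫ t in 0..x, g t := by
  rw [intervalIntegral.integral_of_le hx.1, intervalIntegral.integral_of_le hx.1]
  exact integral_congr_ae (ae_restrict_of_ae_restrict_of_subset (Ioc_subset_Ioc_right hx.2) h)

/-- The antiderivative `x ↦ c + ∫₀ˣ g` of `g` with initial value `c`. -/
noncomputable def antideriv (l : ℝ) : ℝ × IntervalL2 l →L[ℝ] C(Icc 0 l, ℝ) :=
  LinearMap.mkContinuous
    { toFun := fun z => ⟨fun x => z.1 + ∫ t in 0..x.1, z.2 t, by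
        refine continuous_const.add ?_
        rw [continuous_iff_continuousAt]
        intro y
        rw [ContinuousAt, tendsto_iff_dist_tendsto_zero]
        have h1 : Filter.Tendsto (fun x : Icc 0 l => √(dist x y) * ‖z.2‖) (nhds y) (nhds 0) := by
          have : Continuous fun x : Icc 0 l => √(dist x y) * ‖z.2‖ := by fun_prop
          simpa using this.tendsto y
        refine squeeze_zero (fun _ => dist_nonneg) (fun x => ?_) h1
        have h0 : (0 : ℝ) ∈ Icc 0 l := ⟨le_rfl, x.2.1.trans x.2.2⟩
        rw [Real.dist_eq, intervalIntegral.integral_interval_sub_left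
          (intervalIntegrable _ h0 x.2) (intervalIntegrable _ h0 y.2), dist_comm]
        exact norm_intervalIntegral_le _ y.2 x.2⟩
      map_add' := fun z w => by
        ext x
        simp only [Prod.snd_add, intervalIntegral_add _ _ x.2, ContinuousMap.coe_mk,
          ContinuousMap.add_apply, Prod.fst_add]
        ring
      map_smul' := fun c z => by
        ext x
        simp only [Prod.smul_snd, intervalIntegral_smul _ _ x.2, ContinuousMap.coe_mk,
          ContinuousMap.smul_apply, Prod.smul_fst, smul_eq_mul, RingHom.id_apply]
        ring }
    (1 + √l) (fun z => by
      refine (ContinuousMap.norm_le _ (by positivity)).2 fun x => ?_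
      have h0 : (0 : ℝ) ∈ Icc 0 l := ⟨le_rfl, x.2.1.trans x.2.2⟩
      have h1 := norm_intervalIntegral_le z.2 h0 x.2
      have h2 : √(dist 0 x.1) ≤ √l := Real.sqrt_le_sqrt (by
        rw [dist_comm, Real.dist_eq, sub_zero, abs_of_nonneg x.2.1]; exact x.2.2)
      have h3 := norm_add_le z.1 (∫ t in 0..x.1, z.2 t)
      have h4 : √(dist 0 x.1) * ‖z.2‖ ≤ √l * ‖z‖ := by
        gcongr
        exact norm_snd_le z
      have h5 := norm_fst_le z
      simp only [LinearMap.coe_mk, AddHom.coe_mk, ContinuousMap.coe_mk]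
      linarith)

theorem antideriv_apply (z : ℝ × IntervalL2 l) (x : Icc 0 l) :
    antideriv l z x = z.1 + ∫ t in 0..x.1, z.2 t := rfl

/-- Arzelà–Ascoli: the image of the unit ball is bounded and has the common modulus of continuity
√t. -/
theorem isCompactOperator_antideriv (l : ℝ) : IsCompactOperator (antideriv l) := by
  refine (isCompactOperator_iff_image_closedBall_subset_compact
    (antideriv l).toLinearMap one_pos).2 ?_
  set T := ContinuousMap.isometryEquivBoundedOfCompact (Icc 0 l) ℝ
  set A : Set (BoundedContinuousFunction (Icc 0 l) ℝ) :=
    (fun z => T (antideriv l z)) '' Metric.closedBall 0 1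
  have hA : IsCompact (closure A) := by
    refine BoundedContinuousFunction.arzela_ascoli
      (Metric.closedBall 0 ‖antideriv l‖) (isCompact_closedBall _ _) A ?_ ?_
    · rintro f x ⟨z, hz, rfl⟩
      rw [mem_closedBall_zero_iff] at hz ⊢
      refine (ContinuousMap.norm_coe_le_norm (antideriv l z) x).trans ?_
      exact ((antideriv l).le_opNorm z).trans (mul_le_of_le_one_right (norm_nonneg _) hz)
    · refine Metric.equicontinuous_of_continuity_modulus (fun t => √t) ?_ _ ?_
      · simpa using Real.continuous_sqrt.tendsto 0
      · rintro x y ⟨_, z, hz, rfl⟩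
        rw [mem_closedBall_zero_iff] at hz
        change dist (antideriv l z x) (antideriv l z y) ≤ _
        have h0 : (0 : ℝ) ∈ Icc 0 l := ⟨le_rfl, x.2.1.trans x.2.2⟩
        rw [antideriv_apply, antideriv_apply, dist_add_left, Real.dist_eq,
          intervalIntegral.integral_interval_sub_left
          (intervalIntegrable _ h0 x.2) (intervalIntegrable _ h0 y.2), dist_comm]
        refine (norm_intervalIntegral_le _ y.2 x.2).trans ?_
        exact mul_le_of_le_one_right (Real.sqrt_nonneg _) ((norm_snd_le z).trans hz)
  refine ⟨T.symm '' closure A, hA.image T.symm.continuous, ?_⟩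
  rintro _ ⟨z, hz, rfl⟩
  exact ⟨T (antideriv l z), subset_closure ⟨z, hz, rfl⟩, T.symm_apply_apply _⟩

theorem IccExtend_antideriv (hl : 0 ≤ l) (z : ℝ × IntervalL2 l) {t : ℝ} (ht : t ∈ Icc 0 l) :
    IccExtend hl (antideriv l z) t = z.1 + ∫ s in 0..t, z.2 s := by
  rw [IccExtend_of_mem hl _ ht]; rfl

theorem continuous_IccExtend (hl : 0 ≤ l) (φ : C(Icc 0 l, ℝ)) : Continuous (IccExtend hl φ) :=
  φ.continuous.Icc_extend'

theorem intervalIntegrable_mul_IccExtend (hl : 0 ≤ l) {q : ℝ → ℝ} (hq : ∀ a b, IntervalIntegrable q volume a b)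
    (φ : C(Icc 0 l, ℝ)) (a b : ℝ) :
    IntervalIntegrable (fun t => q t * IccExtend hl φ t) volume a b :=
  (hq a b).mul_continuousOn (continuous_IccExtend hl φ).continuousOn

/-- Integration over `[0, l]` against an integrable weight. -/
noncomputable def weightedIntegral (hl : 0 ≤ l) (q : ℝ → ℝ) (hq : ∀ a b, IntervalIntegrable q volume a b) :
    C(Icc 0 l, ℝ) →L[ℝ] ℝ :=
  LinearMap.mkContinuous
    { toFun := fun φ => ∫ t in 0..l, q t * IccExtend hl φ t
      map_add' := fun φ ψ => by
        rw [← intervalIntegral.integral_add (intervalIntegrable_mul_IccExtend hl hq φ _ _)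
          (intervalIntegrable_mul_IccExtend hl hq ψ _ _)]
        simp [IccExtend, mul_add]
      map_smul' := fun c φ => by
        rw [RingHom.id_apply, smul_eq_mul, ← intervalIntegral.integral_const_mul]
        simp [IccExtend, mul_left_comm] }
    (∫ t in 0..l, ‖q t‖) (fun φ => by
      rw [← intervalIntegral.integral_mul_const]
      refine (intervalIntegral.norm_integral_le_integral_norm hl).trans ?_
      refine intervalIntegral.integral_mono_on hl
        (intervalIntegrable_mul_IccExtend hl hq φ _ _).norm
        ((hq _ _).norm.mul_const _) fun t ht => ?_
      rw [norm_mul]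
      gcongr
      exact ContinuousMap.norm_coe_le_norm φ _)

theorem weightedIntegral_apply (hl : 0 ≤ l) {q : ℝ → ℝ} (hq : ∀ a b, IntervalIntegrable q volume a b)
    (φ : C(Icc 0 l, ℝ)) : weightedIntegral hl q hq φ = ∫ t in 0..l, q t * IccExtend hl φ t := rfl

/-- Integration by parts, for `F` absolutely continuous with derivative `r`. -/
theorem integral_mul_add_integral_mul_primitive (hl : 0 ≤ l) {F r k : ℝ → ℝ}
    (hF : AbsolutelyContinuousOnInterval F 0 l)
    (hr : ∀ᵐ x ∂volume.restrict (Ioc 0 l), HasDerivAt F (r x) x)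
    (hk : IntervalIntegrable k volume 0 l) (w : ℝ) :
    (∫ t in 0..l, F t * k t) + ∫ t in 0..l, r t * (w + ∫ s in 0..t, k s) =
      F l * (w + ∫ s in 0..l, k s) - F 0 * w := by
  have h0 : (0 : ℝ) ∈ uIcc 0 l := left_mem_uIcc
  have hη : AbsolutelyContinuousOnInterval (fun t => w + ∫ s in 0..t, k s) 0 l := by
    have h1 : AbsolutelyContinuousOnInterval (fun _ : ℝ => w) 0 l :=
      (LipschitzWith.const w).lipschitzOnWith.absolutelyContinuousOnInterval
    exact h1.add (hk.absolutelyContinuousOnInterval_intervalIntegral h0)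
  have hdη : ∀ᵐ x ∂volume.restrict (Ioc 0 l), deriv (fun t => w + ∫ s in 0..t, k s) x = k x := by
    rw [ae_restrict_iff' measurableSet_Ioc]
    filter_upwards [hk.ae_hasDerivAt_integral] with x hx hxI
    exact ((hx (by rw [uIcc_of_le hl]; exact Ioc_subset_Icc_self hxI) 0 h0).const_add w).deriv
  have h2 := hF.integral_mul_deriv_eq_deriv_mul hη
  rw [intervalIntegral.integral_same, add_zero] at h2
  have h3 : ∫ t in 0..l, F t * deriv (fun t => w + ∫ s in 0..t, k s) t = ∫ t in 0..l, F t * k t := by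
    refine intervalIntegral_congr_ae ?_ (right_mem_Icc.2 hl)
    filter_upwards [hdη] with x hx
    rw [hx]
  have h4 : ∫ t in 0..l, deriv F t * (w + ∫ s in 0..t, k s) =
      ∫ t in 0..l, r t * (w + ∫ s in 0..t, k s) := by
    refine intervalIntegral_congr_ae ?_ (right_mem_Icc.2 hl)
    filter_upwards [hr] with x hx
    rw [hx.deriv]
  rw [h3, h4] at h2
  linarith

end IntervalL2

/-! ### Form domain, quadratic form and existence of a minimizer. -/

namespace MetricGraph

variable {V E : Type*}

theorem finite_vertices [Finite E] (Γ : MetricGraph V E) : Finite V := by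
  refine Finite.of_surjective (fun p : E × Bool => bif p.2 then Γ.src p.1 else Γ.tgt p.1) ?_
  intro v
  obtain ⟨e, h | h⟩ := Γ.incident v
  · exact ⟨(e, true), h⟩
  · exact ⟨(e, false), h⟩

/-- Vertex values together with square integrable derivatives on the edges. -/
abbrev VertexEdgeData (Γ : MetricGraph V E) : Type _ :=
  (V → ℝ) × ∀ e, IntervalL2 (Γ.len e)

variable (Γ : MetricGraph V E)

theorem len_nonneg (e : E) : 0 ≤ Γ.len e := (Γ.len_pos e).le

/-- The function on the edge `e` with the prescribed value at the source and the prescribed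
derivative. -/
noncomputable def edgeFunction (e : E) : Γ.VertexEdgeData →L[ℝ] C(Icc 0 (Γ.len e), ℝ) :=
  (IntervalL2.antideriv (Γ.len e)).comp
    (((ContinuousLinearMap.proj (Γ.src e)).comp (ContinuousLinearMap.fst ℝ _ _)).prod
      ((ContinuousLinearMap.proj e).comp (ContinuousLinearMap.snd ℝ _ _)))

theorem edgeFunction_eq (e : E) (z : Γ.VertexEdgeData) :
    Γ.edgeFunction e z = IntervalL2.antideriv (Γ.len e) (z.1 (Γ.src e), z.2 e) := rfl

theorem edgeFunction_extend (e : E) (z : Γ.VertexEdgeData) {t : ℝ} (ht : t ∈ Icc 0 (Γ.len e)) :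
    IccExtend (Γ.len_nonneg e) (Γ.edgeFunction e z) t =
      z.1 (Γ.src e) + ∫ s in 0..t, z.2 e s :=
  IntervalL2.IccExtend_antideriv _ _ ht

/-- The form domain: functions continuous on the graph, with square integrable derivative,
vanishing at the Dirichlet vertices. -/
noncomputable def energySpace (α : V → WithTop ℝ) : Submodule ℝ Γ.VertexEdgeData where
  carrier := {z | (∀ e, Γ.edgeFunction e z ⟨Γ.len e, right_mem_Icc.2 (Γ.len_nonneg e)⟩ =
    z.1 (Γ.tgt e)) ∧ ∀ v, α v = ⊤ → z.1 v = 0}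
  add_mem' := fun ha hb => ⟨fun e => by simp [ha.1 e, hb.1 e], fun v hv => by
    simp [ha.2 v hv, hb.2 v hv]⟩
  zero_mem' := by simp
  smul_mem' := fun c z hz => ⟨fun e => by simp [hz.1 e], fun v hv => by simp [hz.2 v hv]⟩

variable {Γ} {α : V → WithTop ℝ}

theorem mem_energySpace {z : Γ.VertexEdgeData} : z ∈ Γ.energySpace α ↔
    (∀ e, z.1 (Γ.src e) + ∫ t in 0..Γ.len e, z.2 e t = z.1 (Γ.tgt e)) ∧
      ∀ v, α v = ⊤ → z.1 v = 0 := Iff.rfl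

theorem isClosed_energySpace : IsClosed (Γ.energySpace α : Set Γ.VertexEdgeData) := by
  have h : (Γ.energySpace α : Set Γ.VertexEdgeData) =
      (⋂ e, {z | Γ.edgeFunction e z ⟨Γ.len e, right_mem_Icc.2 (Γ.len_nonneg e)⟩ =
        z.1 (Γ.tgt e)}) ∩ ⋂ v, ⋂ _ : α v = ⊤, {z | z.1 v = 0} := by
    ext z
    simp only [mem_inter_iff, mem_iInter]
    rfl
  rw [h]
  refine (isClosed_iInter fun e => isClosed_eq ?_ (by fun_prop)).inter
    (isClosed_iInter fun v => isClosed_iInter fun _ => isClosed_eq (by fun_prop) (by fun_prop))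
  exact (continuous_eval_const (F := C(Icc 0 (Γ.len e), ℝ)) _).comp (Γ.edgeFunction e).continuous

variable (Γ α)

/-- The inclusion of the form domain into the continuous functions on the edges. -/
noncomputable def toContinuous : Γ.energySpace α →L[ℝ] ∀ e, C(Icc 0 (Γ.len e), ℝ) :=
  (ContinuousLinearMap.pi Γ.edgeFunction).comp (Γ.energySpace α).subtypeL

variable [Fintype E]

theorem isCompactOperator_toContinuous : IsCompactOperator (Γ.toContinuous α) := by
  have h : ∀ e, IsCompactOperator (Γ.edgeFunction e) := fun e =>
    (IntervalL2.isCompactOperator_antideriv (Γ.len e)).comp_clm _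
  have h1 : IsCompactOperator (ContinuousLinearMap.pi Γ.edgeFunction) := by
    choose K hK hKn using h
    refine ⟨Set.pi univ K, isCompact_univ_pi hK, ?_⟩
    have : ⇑(ContinuousLinearMap.pi Γ.edgeFunction) ⁻¹' Set.pi univ K =
        ⋂ e, ⇑(Γ.edgeFunction e) ⁻¹' K e := by
      ext z; simp
    rw [this]
    exact Filter.iInter_mem.2 hKn
  exact h1.comp_clm _

/-- The `L²` inner product on continuous functions on the edges. -/
noncomputable def massForm : LinearMap.BilinForm ℝ (∀ e, C(Icc 0 (Γ.len e), ℝ)) :=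
  LinearMap.mk₂ ℝ (fun φ ψ => ∑ e, IntervalL2.weightedIntegral (Γ.len_nonneg e) (fun _ => 1)
      (fun _ _ => intervalIntegrable_const) (φ e * ψ e))
    (fun _ _ _ => by simp [add_mul, Finset.sum_add_distrib])
    (fun _ _ _ => by simp [Finset.mul_sum])
    (fun _ _ _ => by simp [mul_add, Finset.sum_add_distrib])
    (fun _ _ _ => by simp [Finset.mul_sum])

theorem massForm_apply (φ ψ : ∀ e, C(Icc 0 (Γ.len e), ℝ)) :
    Γ.massForm φ ψ = ∑ e, IntervalL2.weightedIntegral (Γ.len_nonneg e) (fun _ => 1)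
      (fun _ _ => intervalIntegrable_const) (φ e * ψ e) := rfl

theorem continuous_massForm : Continuous fun φ => Γ.massForm φ φ := by
  simp only [massForm_apply]
  fun_prop

theorem massForm_pos {φ : ∀ e, C(Icc 0 (Γ.len e), ℝ)} (h : φ ≠ 0) : 0 < Γ.massForm φ φ := by
  obtain ⟨e, he⟩ := Function.ne_iff.1 h
  obtain ⟨x, hx⟩ := DFunLike.ne_iff.1 he
  have hw : ∀ e, IntervalL2.weightedIntegral (Γ.len_nonneg e) (fun _ => 1)
      (fun _ _ => intervalIntegrable_const) (φ e * φ e) =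
      ∫ t in 0..Γ.len e, IccExtend (Γ.len_nonneg e) (φ e) t ^ 2 := fun e => by
    rw [IntervalL2.weightedIntegral_apply]
    simp [IccExtend, sq]
  have hc : ∀ e, Continuous fun t => IccExtend (Γ.len_nonneg e) (φ e) t ^ 2 := fun e =>
    (IntervalL2.continuous_IccExtend _ _).pow 2
  rw [massForm_apply]
  refine Finset.sum_pos' (fun e _ => ?_) ⟨e, Finset.mem_univ _, ?_⟩
  · rw [hw]
    exact intervalIntegral.integral_nonneg (Γ.len_nonneg e) fun t _ => sq_nonneg _
  · rw [hw]
    refine intervalIntegral.integral_pos (Γ.len_pos e) (hc e).continuousOn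
      (fun _ _ => sq_nonneg _) ⟨x.1, x.2, ?_⟩
    rw [IccExtend_val]
    exact sq_pos_of_ne_zero hx

theorem norm_edgeFunction_le (z : Γ.energySpace α) (e : E) :
    ‖Γ.edgeFunction e z‖ ≤ ‖Γ.toContinuous α z‖ :=
  norm_le_pi_norm (Γ.toContinuous α z) e

/-- Every vertex is an end of some edge, so its value is a value of an edge function. Hence the
coupling terms are of lower order. -/
theorem norm_vertex_le (z : Γ.energySpace α) (v : V) :
    ‖z.1.1 v‖ ≤ ‖Γ.toContinuous α z‖ := by
  obtain ⟨e, rfl | rfl⟩ := Γ.incident v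
  · refine le_trans ?_ (Γ.norm_edgeFunction_le α z e)
    have h := ContinuousMap.norm_coe_le_norm (Γ.edgeFunction e z)
      ⟨0, left_mem_Icc.2 (Γ.len_nonneg e)⟩
    rwa [edgeFunction_eq, IntervalL2.antideriv_apply, intervalIntegral.integral_same,
      add_zero] at h
  · refine le_trans ?_ (Γ.norm_edgeFunction_le α z e)
    rw [← z.2.1 e]
    exact ContinuousMap.norm_coe_le_norm _ _

variable [Fintype V]

/-- The quadratic form of the Schrödinger operator. -/
noncomputable def energyForm (q : E → ℝ → ℝ) (hq : ∀ e a b, IntervalIntegrable (q e) volume a b) :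
    LinearMap.BilinForm ℝ Γ.VertexEdgeData :=
  LinearMap.mk₂ ℝ (fun z w => (∑ e, inner ℝ (z.2 e) (w.2 e)) +
      (∑ e, IntervalL2.weightedIntegral (Γ.len_nonneg e) (q e) (hq e)
        (Γ.edgeFunction e z * Γ.edgeFunction e w)) +
      -- The default 0 at Dirichlet vertices is harmless, since members of `energySpace` vanish
      -- there.
      ∑ v, (α v).untopD 0 * (z.1 v * w.1 v))
    (fun _ _ _ => by
      simp only [Prod.snd_add, Prod.fst_add, Pi.add_apply, inner_add_left, map_add, add_mul,
        mul_add, Finset.sum_add_distrib]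
      ring)
    (fun c _ _ => by
      simp only [Prod.smul_snd, Prod.smul_fst, Pi.smul_apply, real_inner_smul_left, map_smul,
        smul_mul_assoc, smul_eq_mul, mul_add, Finset.mul_sum, mul_left_comm c, mul_assoc])
    (fun _ _ _ => by
      simp only [Prod.snd_add, Prod.fst_add, Pi.add_apply, inner_add_right, map_add,
        mul_add, Finset.sum_add_distrib]
      ring)
    (fun c _ _ => by
      simp only [Prod.smul_snd, Prod.smul_fst, Pi.smul_apply, real_inner_smul_right, map_smul,
        mul_smul_comm, smul_eq_mul, mul_add, Finset.mul_sum, mul_left_comm c])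

variable {q : E → ℝ → ℝ} (hq : ∀ e a b, IntervalIntegrable (q e) volume a b)

theorem energyForm_apply (z w : Γ.VertexEdgeData) :
    Γ.energyForm α q hq z w = (∑ e, inner ℝ (z.2 e) (w.2 e)) +
      (∑ e, IntervalL2.weightedIntegral (Γ.len_nonneg e) (q e) (hq e)
        (Γ.edgeFunction e z * Γ.edgeFunction e w)) +
      ∑ v, (α v).untopD 0 * (z.1 v * w.1 v) := rfl

theorem continuous_energyForm : Continuous fun z => Γ.energyForm α q hq z z := by
  simp only [energyForm_apply]
  fun_prop

theorem energyForm_symm (z w : Γ.VertexEdgeData) :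
    Γ.energyForm α q hq z w = Γ.energyForm α q hq w z := by
  simp only [energyForm_apply, real_inner_comm, mul_comm]

/-- The derivative part controls the norm up to the vertex values. These, the potential term and the
couplings are all bounded by multiples of the squared sup norm, which M absorbs. -/
theorem energyForm_garding : ∃ M : ℝ, ∀ z : Γ.energySpace α,
    1 * ‖z‖ ^ 2 ≤ (Γ.energyForm α q hq).restrict (Γ.energySpace α) z z +
      M * ‖Γ.toContinuous α z‖ ^ 2 := by
  refine ⟨(∑ e, ‖IntervalL2.weightedIntegral (Γ.len_nonneg e) (q e) (hq e)‖) +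
    (∑ v, ‖(α v).untopD 0‖) + 1, fun z => ?_⟩
  set r := ‖Γ.toContinuous α z‖ with hr
  have h1 : ‖z.1.1‖ ≤ r := (pi_norm_le_iff_of_nonneg (norm_nonneg _)).2 (Γ.norm_vertex_le α z)
  have h2 : ‖z.1.2‖ ≤ √(∑ e, ‖z.1.2 e‖ ^ 2) := by
    refine (pi_norm_le_iff_of_nonneg (Real.sqrt_nonneg _)).2 fun e => Real.le_sqrt_of_sq_le ?_
    exact Finset.single_le_sum (f := fun e => ‖z.1.2 e‖ ^ 2) (fun _ _ => sq_nonneg _)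
      (Finset.mem_univ e)
  have h2' : ‖z.1.2‖ ^ 2 ≤ ∑ e, ‖z.1.2 e‖ ^ 2 := by
    refine (pow_le_pow_left₀ (norm_nonneg _) h2 2).trans ?_
    rw [Real.sq_sqrt (Finset.sum_nonneg fun _ _ => sq_nonneg _)]
  have h1' : ‖z.1.1‖ ^ 2 ≤ r ^ 2 := pow_le_pow_left₀ (norm_nonneg _) h1 2
  have h3 : ‖z‖ ^ 2 ≤ r ^ 2 + ∑ e, ‖z.1.2 e‖ ^ 2 := by
    have h : ‖z‖ = max ‖z.1.1‖ ‖z.1.2‖ := rfl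
    rw [h]
    rcases max_cases ‖z.1.1‖ ‖z.1.2‖ with ⟨h, -⟩ | ⟨h, -⟩ <;> rw [h]
    · have : 0 ≤ ∑ e, ‖z.1.2 e‖ ^ 2 := Finset.sum_nonneg fun _ _ => sq_nonneg _
      linarith
    · nlinarith [sq_nonneg r]
  have h4 : -(∑ e, ‖IntervalL2.weightedIntegral (Γ.len_nonneg e) (q e) (hq e)‖) * r ^ 2 ≤
      ∑ e, IntervalL2.weightedIntegral (Γ.len_nonneg e) (q e) (hq e)
        (Γ.edgeFunction e z * Γ.edgeFunction e z) := by
    rw [neg_mul, Finset.sum_mul, ← Finset.sum_neg_distrib]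
    refine Finset.sum_le_sum fun e _ => ?_
    refine (neg_le_neg ?_).trans (neg_abs_le _)
    refine ((IntervalL2.weightedIntegral (Γ.len_nonneg e) (q e) (hq e)).le_opNorm _).trans ?_
    gcongr
    refine (norm_mul_le _ _).trans ?_
    rw [← sq]
    exact pow_le_pow_left₀ (norm_nonneg _) (Γ.norm_edgeFunction_le α z e) 2
  have h5 : -(∑ v, ‖(α v).untopD 0‖) * r ^ 2 ≤ ∑ v, (α v).untopD 0 * (z.1.1 v * z.1.1 v) := by
    rw [neg_mul, Finset.sum_mul, ← Finset.sum_neg_distrib]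
    refine Finset.sum_le_sum fun v _ => ?_
    refine (neg_le_neg ?_).trans (neg_abs_le _)
    rw [← Real.norm_eq_abs, norm_mul, norm_mul, ← sq]
    gcongr
    exact Γ.norm_vertex_le α z v
  rw [LinearMap.BilinForm.restrict_apply]
  change _ ≤ Γ.energyForm α q hq z z + _
  rw [energyForm_apply]
  simp only [real_inner_self_eq_norm_sq]
  linarith

/-- The generalized eigenvalue problem in the form domain has a smallest solution. -/
theorem exists_minimizer (hne : ∃ z ∈ Γ.energySpace α, ∃ e, Γ.edgeFunction e z ≠ 0) :
    ∃ lam : ℝ, ∃ z ∈ Γ.energySpace α, (∃ e, Γ.edgeFunction e z ≠ 0) ∧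
      (∀ w ∈ Γ.energySpace α, Γ.energyForm α q hq z w =
        lam * Γ.massForm (fun e => Γ.edgeFunction e z) (fun e => Γ.edgeFunction e w)) ∧
      ∀ w ∈ Γ.energySpace α,
        lam * Γ.massForm (fun e => Γ.edgeFunction e w) (fun e => Γ.edgeFunction e w) ≤
          Γ.energyForm α q hq w w := by
  have : CompleteSpace (Γ.energySpace α) :=
    (isClosed_energySpace (Γ := Γ) (α := α)).completeSpace_coe
  obtain ⟨M, hM⟩ := Γ.energyForm_garding α hq
  obtain ⟨z₀, hz₀, e₀, he₀⟩ := hne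
  obtain ⟨lam, z, hz, hzw, hmin⟩ := exists_smallest_eigenvalue_of_isCompactOperator
    (Γ.toContinuous α) (Γ.isCompactOperator_toContinuous α)
    ((Γ.energyForm α q hq).restrict (Γ.energySpace α))
    (fun x y => Γ.energyForm_symm α hq x y)
    ((Γ.continuous_energyForm α hq).comp continuous_subtype_val)
    Γ.massForm (fun x y => by simp only [massForm_apply, mul_comm])
    Γ.continuous_massForm (fun _ => Γ.massForm_pos) one_pos hM
    ⟨⟨z₀, hz₀⟩, fun h => he₀ (congrFun h e₀)⟩
  exact ⟨lam, z, z.2, Function.ne_iff.1 hz, fun w hw => hzw ⟨w, hw⟩, fun w hw => hmin ⟨w, hw⟩⟩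

end MetricGraph

/-! ### Weak solutions and eigenfunctions. -/

namespace MetricGraph

variable {V E : Type*} [Fintype V] [Fintype E] [DecidableEq V] (Γ : MetricGraph V E)
  {α : V → WithTop ℝ} {q : E → ℝ → ℝ} (hq : ∀ e a b, IntervalIntegrable (q e) volume a b)

omit [Fintype V] [Fintype E] [DecidableEq V] in
theorem weightedIntegral_mul_eq {e : E} {p : ℝ → ℝ} (hp : ∀ a b, IntervalIntegrable p volume a b)
    (φ : C(Icc 0 (Γ.len e), ℝ)) (w : Γ.VertexEdgeData) :
    IntervalL2.weightedIntegral (Γ.len_nonneg e) p hp (φ * Γ.edgeFunction e w) =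
      ∫ t in 0..Γ.len e, p t * IccExtend (Γ.len_nonneg e) φ t *
        (w.1 (Γ.src e) + ∫ s in 0..t, w.2 e s) := by
  rw [IntervalL2.weightedIntegral_apply]
  refine intervalIntegral.integral_congr fun t ht => ?_
  rw [uIcc_of_le (Γ.len_nonneg e)] at ht
  simp only [← Γ.edgeFunction_extend e w ht, IccExtend, Function.comp_apply,
    ContinuousMap.mul_apply, mul_assoc]

omit [DecidableEq V] in
/-- The form of `H_q - μ`, collected edge by edge. -/
theorem energyForm_sub_massForm (μ : ℝ) (z w : Γ.VertexEdgeData) :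
    Γ.energyForm α q hq z w -
      μ * Γ.massForm (fun e => Γ.edgeFunction e z) (fun e => Γ.edgeFunction e w) =
    (∑ e, ((∫ t in 0..Γ.len e, z.2 e t * w.2 e t) + ∫ t in 0..Γ.len e,
      (q e t - μ) * IccExtend (Γ.len_nonneg e) (Γ.edgeFunction e z) t *
        (w.1 (Γ.src e) + ∫ s in 0..t, w.2 e s))) +
      ∑ v, (α v).untopD 0 * (z.1 v * w.1 v) := by
  have hq' : ∀ e a b, IntervalIntegrable (fun t => q e t - μ) volume a b := fun e a b =>
    (hq e a b).sub intervalIntegrable_const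
  have h : ∀ e, IntervalL2.weightedIntegral (Γ.len_nonneg e) (fun t => q e t - μ) (hq' e)
      (Γ.edgeFunction e z * Γ.edgeFunction e w) =
      IntervalL2.weightedIntegral (Γ.len_nonneg e) (q e) (hq e)
        (Γ.edgeFunction e z * Γ.edgeFunction e w) -
      μ * IntervalL2.weightedIntegral (Γ.len_nonneg e) (fun _ => 1)
        (fun _ _ => intervalIntegrable_const) (Γ.edgeFunction e z * Γ.edgeFunction e w) := by
    intro e
    simp only [IntervalL2.weightedIntegral_apply, one_mul]
    rw [← intervalIntegral.integral_const_mul, ← intervalIntegral.integral_sub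
      (IntervalL2.intervalIntegrable_mul_IccExtend _ (hq e) _ _ _)
      ((IntervalL2.continuous_IccExtend _ _).intervalIntegrable _ _ |>.const_mul _)]
    simp only [sub_mul]
  simp only [← Γ.weightedIntegral_mul_eq (hq' _), h,
    ← IntervalL2.inner_eq_intervalIntegral (Γ.len_nonneg _), energyForm_apply, massForm_apply,
    Finset.mul_sum, Finset.sum_add_distrib, Finset.sum_sub_distrib]
  ring

/-- Regroups edge boundary terms by vertex. The sign arises because the outward derivative is F at
the source end and −F at the target end. -/
theorem sum_boundary_eq (F : E → ℝ → ℝ) (w : V → ℝ) :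
    ∑ e, (F e (Γ.len e) * w (Γ.tgt e) - F e 0 * w (Γ.src e)) =
      -∑ v, Γ.outwardDerivSum F v * w v := by
  simp only [outwardDerivSum, Finset.sum_mul]
  rw [Finset.sum_comm, ← Finset.sum_neg_distrib]
  refine Finset.sum_congr rfl fun e _ => ?_
  simp only [add_mul, ite_mul, zero_mul, Finset.sum_add_distrib, Finset.sum_ite_eq,
    Finset.mem_univ, if_true]
  ring

/-- Green's formula for the form of `H_q - μ`. -/
theorem energyForm_sub_massForm_eq_sum_vertices {μ : ℝ} {z w : Γ.VertexEdgeData}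
    (hw : w ∈ Γ.energySpace α) {F : E → ℝ → ℝ}
    (hF : ∀ e, AbsolutelyContinuousOnInterval (F e) 0 (Γ.len e))
    (hF' : ∀ e, ∀ᵐ x ∂volume.restrict (Ioc 0 (Γ.len e)), HasDerivAt (F e)
      ((q e x - μ) * IccExtend (Γ.len_nonneg e) (Γ.edgeFunction e z) x) x)
    (hz : ∀ e, z.2 e =ᵐ[volume.restrict (Ioc 0 (Γ.len e))] F e) :
    Γ.energyForm α q hq z w -
      μ * Γ.massForm (fun e => Γ.edgeFunction e z) (fun e => Γ.edgeFunction e w) =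
    ∑ v, ((α v).untopD 0 * z.1 v - Γ.outwardDerivSum F v) * w.1 v := by
  rw [energyForm_sub_massForm]
  have h : ∀ e, ((∫ t in 0..Γ.len e, z.2 e t * w.2 e t) + ∫ t in 0..Γ.len e,
      (q e t - μ) * IccExtend (Γ.len_nonneg e) (Γ.edgeFunction e z) t *
        (w.1 (Γ.src e) + ∫ s in 0..t, w.2 e s)) =
      F e (Γ.len e) * w.1 (Γ.tgt e) - F e 0 * w.1 (Γ.src e) := by
    intro e
    have hI : Γ.len e ∈ Icc 0 (Γ.len e) := right_mem_Icc.2 (Γ.len_nonneg e)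
    have h1 := IntervalL2.integral_mul_add_integral_mul_primitive (Γ.len_nonneg e) (hF e) (hF' e)
      ((w.2 e).intervalIntegrable (left_mem_Icc.2 (Γ.len_nonneg e)) hI) (w.1 (Γ.src e))
    rw [(mem_energySpace.1 hw).1 e] at h1
    rw [← h1]
    congr 1
    refine IntervalL2.intervalIntegral_congr_ae ?_ hI
    filter_upwards [hz e] with t ht
    rw [ht]
  rw [Finset.sum_congr rfl fun e _ => h e, sum_boundary_eq]
  simp only [sub_mul, Finset.sum_sub_distrib, mul_assoc]
  ring

/-- The antiderivative of `(q - μ) f` on an edge. -/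
noncomputable def slopeCandidate (q : E → ℝ → ℝ) (μ : ℝ) (z : Γ.VertexEdgeData) (c : E → ℝ)
    (e : E) (x : ℝ) : ℝ :=
  c e + ∫ t in 0..x, (q e t - μ) * IccExtend (Γ.len_nonneg e) (Γ.edgeFunction e z) t

variable {Γ}

include hq

omit [Fintype V] [Fintype E] [DecidableEq V] in
theorem intervalIntegrable_slope (μ : ℝ) (z : Γ.VertexEdgeData) (e : E) (a b : ℝ) :
    IntervalIntegrable (fun t => (q e t - μ) *
      IccExtend (Γ.len_nonneg e) (Γ.edgeFunction e z) t) volume a b :=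
  IntervalL2.intervalIntegrable_mul_IccExtend _
    (fun a b => (hq e a b).sub intervalIntegrable_const) _ _ _

omit [Fintype V] [Fintype E] [DecidableEq V] in
theorem continuous_slopeCandidate (μ : ℝ) (z : Γ.VertexEdgeData) (c : E → ℝ) (e : E) :
    Continuous (Γ.slopeCandidate q μ z c e) :=
  continuous_const.add
    (intervalIntegral.continuous_primitive (intervalIntegrable_slope hq μ z e) 0)

omit [Fintype V] [Fintype E] [DecidableEq V] in
theorem absolutelyContinuous_slopeCandidate (μ : ℝ) (z : Γ.VertexEdgeData) (c : E → ℝ) (e : E) :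
    AbsolutelyContinuousOnInterval (Γ.slopeCandidate q μ z c e) 0 (Γ.len e) := by
  have h1 : AbsolutelyContinuousOnInterval (fun _ : ℝ => c e) 0 (Γ.len e) :=
    (LipschitzWith.const (c e)).lipschitzOnWith.absolutelyContinuousOnInterval
  exact h1.add ((intervalIntegrable_slope hq μ z e 0
    (Γ.len e)).absolutelyContinuousOnInterval_intervalIntegral left_mem_uIcc)

omit [Fintype V] [Fintype E] [DecidableEq V] in
theorem ae_hasDerivAt_slopeCandidate (μ : ℝ) (z : Γ.VertexEdgeData) (c : E → ℝ) (e : E) :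
    ∀ᵐ x ∂volume.restrict (Ioc 0 (Γ.len e)), HasDerivAt (Γ.slopeCandidate q μ z c e)
      ((q e x - μ) * IccExtend (Γ.len_nonneg e) (Γ.edgeFunction e z) x) x := by
  rw [ae_restrict_iff' measurableSet_Ioc]
  filter_upwards [(intervalIntegrable_slope hq μ z e 0 (Γ.len e)).ae_hasDerivAt_integral]
    with x hx hxI
  refine (hx ?_ 0 left_mem_uIcc).const_add (c e)
  rw [uIcc_of_le (Γ.len_nonneg e)]
  exact Ioc_subset_Icc_self hxI

omit [DecidableEq V] in
/-- The derivative of a weak solution is, up to a constant, the antiderivative of `(q - μ) f`. -/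
theorem exists_ae_eq_slopeCandidate {μ : ℝ} {z : Γ.VertexEdgeData}
    (hz : ∀ w ∈ Γ.energySpace α, Γ.energyForm α q hq z w =
      μ * Γ.massForm (fun e => Γ.edgeFunction e z) (fun e => Γ.edgeFunction e w)) :
    ∃ c : E → ℝ, ∀ e,
      z.2 e =ᵐ[volume.restrict (Ioc 0 (Γ.len e))] Γ.slopeCandidate q μ z c e := by
  classical
  set G := Γ.slopeCandidate q μ z 0 with hG
  -- Taking c to be the mean of z' − G makes k = z' − F integrate to zero, so the primitive of k
  -- vanishes at both ends of the edge and is an admissible test function.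
  set c : E → ℝ := fun e => (Γ.len e)⁻¹ * ∫ t in 0..Γ.len e, (z.2 e t - G e t) with hc
  refine ⟨c, fun e => ?_⟩
  set F := Γ.slopeCandidate q μ z c e with hF
  have hFG : ∀ t, F t = c e + G e t := fun t => by simp [hF, hG, slopeCandidate]
  have hFc : Continuous F := continuous_slopeCandidate hq μ z c e
  have hGc : Continuous (G e) := continuous_slopeCandidate hq μ z 0 e
  have h0 : (0 : ℝ) ∈ Icc 0 (Γ.len e) := left_mem_Icc.2 (Γ.len_nonneg e)
  have hI : Γ.len e ∈ Icc 0 (Γ.len e) := right_mem_Icc.2 (Γ.len_nonneg e)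
  have hFm : MemLp F 2 (volume.restrict (Ioc 0 (Γ.len e))) := by
    obtain ⟨C, hC⟩ := isCompact_Icc.exists_bound_of_continuousOn
      (hFc.continuousOn (s := Icc 0 (Γ.len e)))
    refine MemLp.of_bound hFc.aestronglyMeasurable C ?_
    rw [ae_restrict_iff' measurableSet_Ioc]
    exact Filter.Eventually.of_forall fun t ht => hC t (Ioc_subset_Icc_self ht)
  set k : IntervalL2 (Γ.len e) := z.2 e - hFm.toLp F with hk
  have hkae : k =ᵐ[volume.restrict (Ioc 0 (Γ.len e))] fun t => z.2 e t - F t := by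
    filter_upwards [Lp.coeFn_sub (z.2 e) (hFm.toLp F), hFm.coeFn_toLp] with t h1 h2
    rw [hk, h1, Pi.sub_apply, h2]
  have hk0 : ∫ t in 0..Γ.len e, k t = 0 := by
    rw [IntervalL2.intervalIntegral_congr_ae hkae hI]
    have h1 : ∀ t, z.2 e t - F t = (z.2 e t - G e t) - c e := fun t => by rw [hFG]; ring
    simp only [h1]
    rw [intervalIntegral.integral_sub (((z.2 e).intervalIntegrable h0 hI).sub
      (hGc.intervalIntegrable _ _)) intervalIntegrable_const, intervalIntegral.integral_const]
    have := (Γ.len_pos e).ne'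
    simp only [hc, sub_zero, smul_eq_mul]
    field_simp
    ring
  have hzero : ∀ e' (x : ℝ), x ∈ Icc 0 (Γ.len e') →
      ∫ t in 0..x, (0 : IntervalL2 (Γ.len e')) t = 0 := fun e' x hx => by
    have := IntervalL2.intervalIntegral_smul 0 (0 : IntervalL2 (Γ.len e')) hx
    rwa [zero_smul, zero_mul] at this
  set w : Γ.VertexEdgeData := (0, Pi.single e k) with hw
  have hwX : w ∈ Γ.energySpace α := by
    rw [mem_energySpace]
    refine ⟨fun e' => ?_, fun _ _ => rfl⟩
    rcases eq_or_ne e' e with rfl | h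
    · simp [hw, hk0]
    · have h2 : w.2 e' = 0 := Pi.single_eq_of_ne h _
      rw [h2, hzero e' _ (right_mem_Icc.2 (Γ.len_nonneg e'))]
      exact add_zero _
  have h1 := sub_eq_zero.2 (hz w hwX)
  rw [energyForm_sub_massForm] at h1
  have hIBP := IntervalL2.integral_mul_add_integral_mul_primitive (Γ.len_nonneg e)
    (absolutelyContinuous_slopeCandidate hq μ z c e) (ae_hasDerivAt_slopeCandidate hq μ z c e)
    (k.intervalIntegrable h0 hI) 0
  rw [Finset.sum_eq_single e] at h1
  · simp only [hw, Pi.single_eq_same, Pi.zero_apply, mul_zero, Finset.sum_const_zero,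
      add_zero] at h1
    rw [hk0, add_zero, mul_zero, mul_zero, sub_zero] at hIBP
    -- The weak equation for z' and integration by parts for F have the same potential term;
    -- subtracting them leaves ⟨z' − F, k⟩ = 0.
    have h2 : (inner ℝ k k : ℝ) = 0 := by
      have h3 : (inner ℝ (hFm.toLp F) k : ℝ) = ∫ t in 0..Γ.len e, F t * k t := by
        rw [IntervalL2.inner_eq_intervalIntegral (Γ.len_nonneg e)]
        refine IntervalL2.intervalIntegral_congr_ae ?_ hI
        filter_upwards [hFm.coeFn_toLp] with t ht
        rw [ht]
      rw [← IntervalL2.inner_eq_intervalIntegral (Γ.len_nonneg e)] at h1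
      conv_lhs => enter [2]; rw [hk]
      rw [inner_sub_left, h3]
      linarith
    have h4 : k = 0 := inner_self_eq_zero.1 h2
    rw [hk, sub_eq_zero] at h4
    rw [h4]
    exact hFm.coeFn_toLp
  · intro e' _ h
    have h2 : w.2 e' = 0 := Pi.single_eq_of_ne h _
    have h3 : ∫ t in 0..Γ.len e', z.2 e' t * w.2 e' t = 0 := by
      rw [← IntervalL2.inner_eq_intervalIntegral (Γ.len_nonneg e'), h2, inner_zero_right]
    rw [h3, zero_add, h2]
    refine (intervalIntegral.integral_congr (g := fun _ => 0) fun t ht => ?_).trans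
      intervalIntegral.integral_zero
    rw [uIcc_of_le (Γ.len_nonneg e')] at ht
    simp only [hzero e' t ht]
    simp [hw]
  · simp

/-- Weak solutions in the form domain are eigenfunctions. -/
theorem isEigenfunction_of_weak {μ : ℝ} {z : Γ.VertexEdgeData} (hzX : z ∈ Γ.energySpace α)
    (hz0 : ∃ e, Γ.edgeFunction e z ≠ 0)
    (hz : ∀ w ∈ Γ.energySpace α, Γ.energyForm α q hq z w =
      μ * Γ.massForm (fun e => Γ.edgeFunction e z) (fun e => Γ.edgeFunction e w)) :
    μ ∈ Γ.eigenvalues q α := by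
  obtain ⟨c, hc⟩ := exists_ae_eq_slopeCandidate hq hz
  set F := Γ.slopeCandidate q μ z c with hF
  have hFc : ∀ e, Continuous (F e) := fun e => continuous_slopeCandidate hq μ z c e
  -- Integrating the continuous representative F of the derivative makes f differentiable
  -- everywhere.
  set f : E → ℝ → ℝ := fun e x => z.1 (Γ.src e) + ∫ t in 0..x, F e t with hf
  have hfe : ∀ e, ∀ x ∈ Icc 0 (Γ.len e),
      f e x = IccExtend (Γ.len_nonneg e) (Γ.edgeFunction e z) x := fun e x hx => by
    rw [Γ.edgeFunction_extend e z hx, IntervalL2.intervalIntegral_congr_ae (hc e) hx]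
  refine ⟨f, F, z.1, ?_, ?_, ?_, ?_, ?_, ?_, ?_, hzX.2⟩
  · obtain ⟨e, he⟩ := hz0
    obtain ⟨x, hx⟩ := DFunLike.ne_iff.1 he
    refine ⟨e, x, x.2, ?_⟩
    rw [hfe e x x.2, IccExtend_val]
    exact hx
  · intro e
    simp [hf]
  · intro e
    have hI : Γ.len e ∈ Icc 0 (Γ.len e) := right_mem_Icc.2 (Γ.len_nonneg e)
    rw [hfe e _ hI, Γ.edgeFunction_extend e z hI, (mem_energySpace.1 hzX).1 e]
  · intro e x _
    exact (((hFc e).integral_hasStrictDerivAt 0 x).hasDerivAt.const_add _).hasDerivWithinAt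
  · exact fun e => absolutelyContinuous_slopeCandidate hq μ z c e
  · intro e
    rw [← restrict_Ioc_eq_restrict_Icc]
    have h1 : ∀ᵐ x ∂volume.restrict (Ioc 0 (Γ.len e)), x ∈ Ioc 0 (Γ.len e) :=
      ae_restrict_mem measurableSet_Ioc
    filter_upwards [ae_hasDerivAt_slopeCandidate hq μ z c e, h1] with x hx hxI
    refine ⟨_, hx, ?_⟩
    rw [hfe e x (Ioc_subset_Icc_self hxI)]
    ring
  · intro v a hva
    -- The test function is affine on each edge, 1 at v and 0 at the other vertices. It is
    -- admissible because α v is finite, and in Green's formula it isolates the condition at v.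
    have hw : ∃ w ∈ Γ.energySpace α, w.1 = Pi.single v 1 := by
      refine ⟨(Pi.single v 1, fun e => (memLp_const ((Γ.len e)⁻¹ *
        ((Pi.single v 1 : V → ℝ) (Γ.tgt e) - (Pi.single v 1 : V → ℝ) (Γ.src e)))).toLp _),
        mem_energySpace.2 ⟨fun e => ?_, fun v' hv' => ?_⟩, rfl⟩
      · rw [IntervalL2.intervalIntegral_congr_ae (MemLp.coeFn_toLp _)
          (right_mem_Icc.2 (Γ.len_nonneg e)), intervalIntegral.integral_const]
        have := (Γ.len_pos e).ne'
        simp only [sub_zero, smul_eq_mul]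
        field_simp
        ring
      · refine Pi.single_eq_of_ne ?_ _
        rintro rfl
        rw [hva] at hv'
        exact WithTop.coe_ne_top hv'
    obtain ⟨w, hwX, hw⟩ := hw
    have h1 := sub_eq_zero.2 (hz w hwX)
    rw [Γ.energyForm_sub_massForm_eq_sum_vertices hq hwX
      (absolutelyContinuous_slopeCandidate hq μ z c) (ae_hasDerivAt_slopeCandidate hq μ z c) hc,
      hw, Finset.sum_eq_single v (fun b _ hb => by simp [hb]) (by simp), hva] at h1
    simp only [WithTop.untopD_coe, Pi.single_eq_same, mul_one] at h1
    linarith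

/-- The Rayleigh quotient of an eigenfunction is its eigenvalue. -/
theorem exists_energyForm_eq_of_mem_eigenvalues {μ : ℝ} (h : μ ∈ Γ.eigenvalues q α) :
    ∃ z ∈ Γ.energySpace α, (∃ e, Γ.edgeFunction e z ≠ 0) ∧ Γ.energyForm α q hq z z =
      μ * Γ.massForm (fun e => Γ.edgeFunction e z) (fun e => Γ.edgeFunction e z) := by
  obtain ⟨f, f', u, hf⟩ := h
  have hcont : ∀ e, ContinuousOn (f' e) (Icc 0 (Γ.len e)) := fun e => by
    have := (hf.absCont e).continuousOn
    rwa [uIcc_of_le (Γ.len_nonneg e)] at this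
  have hm : ∀ e, MemLp (f' e) 2 (volume.restrict (Ioc 0 (Γ.len e))) := fun e => by
    obtain ⟨C, hC⟩ := isCompact_Icc.exists_bound_of_continuousOn (hcont e)
    refine MemLp.of_bound (((hcont e).mono Ioc_subset_Icc_self).aestronglyMeasurable
      measurableSet_Ioc) C ?_
    rw [ae_restrict_iff' measurableSet_Ioc]
    exact Filter.Eventually.of_forall fun t ht => hC t (Ioc_subset_Icc_self ht)
  set z : Γ.VertexEdgeData := (u, fun e => (hm e).toLp (f' e)) with hz
  have hfz : ∀ e, ∀ x ∈ Icc 0 (Γ.len e), z.1 (Γ.src e) + ∫ t in 0..x, z.2 e t = f e x := by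
    intro e x hx
    rw [IntervalL2.intervalIntegral_congr_ae (hm e).coeFn_toLp hx,
      intervalIntegral.integral_eq_sub_of_hasDeriv_right_of_le hx.1 (f := f e)
        (fun t ht => ((hf.hasDeriv e t ⟨ht.1, ht.2.trans hx.2⟩).continuousWithinAt).mono
          (Icc_subset_Icc_right hx.2))
        (fun t ht => (hf.hasDeriv e t ⟨ht.1.le, ht.2.le.trans hx.2⟩).mono_of_mem_nhdsWithin
          (mem_nhdsWithin_of_mem_nhds (Icc_mem_nhds ht.1 (ht.2.trans_le hx.2))))
        (((hcont e).mono (Icc_subset_Icc_right hx.2)).intervalIntegrable_of_Icc hx.1),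
      hf.eq_src]
    simp [hz]
  have hzX : z ∈ Γ.energySpace α := mem_energySpace.2
    ⟨fun e => by rw [hfz e _ (right_mem_Icc.2 (Γ.len_nonneg e)), hf.eq_tgt], hf.dirichlet⟩
  have hext : ∀ e, ∀ x ∈ Icc 0 (Γ.len e),
      IccExtend (Γ.len_nonneg e) (Γ.edgeFunction e z) x = f e x := fun e x hx => by
    rw [Γ.edgeFunction_extend e z hx, hfz e x hx]
  refine ⟨z, hzX, ?_, ?_⟩
  · obtain ⟨e, x, hx, hne⟩ := hf.nonzero
    refine ⟨e, fun h => hne ?_⟩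
    rw [← hext e x hx, IccExtend_of_mem _ _ hx, h]
    rfl
  · rw [← sub_eq_zero, Γ.energyForm_sub_massForm_eq_sum_vertices hq hzX hf.absCont ?_
      (fun e => (hm e).coeFn_toLp)]
    · refine Finset.sum_eq_zero fun v _ => ?_
      rcases h : α v with _ | a
      · rw [show z.1 v = 0 from hf.dirichlet v h, mul_zero]
      · have := hf.coupling v a h
        rw [this]
        change ((a : WithTop ℝ).untopD 0 * u v - a * u v) * u v = 0
        simp
    · intro e
      have h1 := hf.eqn e
      rw [← restrict_Ioc_eq_restrict_Icc] at h1
      have h2 : ∀ᵐ x ∂volume.restrict (Ioc 0 (Γ.len e)), x ∈ Ioc 0 (Γ.len e) :=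
        ae_restrict_mem measurableSet_Ioc
      filter_upwards [h1, h2] with x ⟨f'', hx, hx'⟩ hxI
      rw [hext e x (Ioc_subset_Icc_self hxI)]
      convert hx using 1
      linarith

end MetricGraph

/-! ### The sine density and the mean of the potential. -/

theorem integral_sin_sq_mul_div {l : ℝ} (hl : 0 < l) :
    ∫ t in 0..l, Real.sin (Real.pi / l * t) ^ 2 = l / 2 := by
  have h := Real.pi_pos.ne'
  rw [intervalIntegral.integral_comp_mul_left (fun x => Real.sin x ^ 2) (by positivity),
    mul_zero, div_mul_cancel₀ _ hl.ne', integral_sin_sq]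
  simp only [Real.sin_zero, Real.sin_pi, zero_mul, sub_zero, zero_add, smul_eq_mul]
  field_simp

theorem integral_cos_sq_mul_div {l : ℝ} (hl : 0 < l) :
    ∫ t in 0..l, Real.cos (Real.pi / l * t) ^ 2 = l / 2 := by
  have h := Real.pi_pos.ne'
  rw [intervalIntegral.integral_comp_mul_left (fun x => Real.cos x ^ 2) (by positivity),
    mul_zero, div_mul_cancel₀ _ hl.ne', integral_cos_sq]
  simp only [Real.sin_zero, Real.sin_pi, mul_zero, sub_zero, zero_add, smul_eq_mul]
  field_simp

/-- The weighted mean of `q` with density `(2 / l) sin²(π t / l)` is at most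
`(2 / l) ^ (1 / p) ‖q₊‖_p`. -/
theorem integral_mul_sin_sq_le {l : ℝ} (hl : 0 < l) {p : ℝ≥0∞} (hp : 1 ≤ p) {q : ℝ → ℝ}
    (hq : MemLp q p (volume.restrict (Icc 0 l))) :
    2 / l * ∫ t in 0..l, q t * Real.sin (Real.pi / l * t) ^ 2 ≤
      (2 / l) ^ (1 / p).toReal *
        (eLpNorm (fun t => max (q t) 0) p (volume.restrict (Icc 0 l))).toReal := by
  set μ := volume.restrict (Icc 0 l) with hμ
  set d : ℝ → ℝ := fun t => 2 / l * Real.sin (Real.pi / l * t) ^ 2 with hd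
  have hdc : Continuous d := by fun_prop
  have hd0 : ∀ t, 0 ≤ d t := fun t => by positivity
  have hd1 : ∀ t, d t ≤ 2 / l := fun t =>
    mul_le_of_le_one_right (by positivity) (Real.sin_sq_le_one _)
  set ν := μ.withDensity (fun t => ENNReal.ofReal (d t)) with hν
  have hdi : Integrable d μ := hdc.integrableOn_Icc
  have hprob : IsProbabilityMeasure ν := by
    refine ⟨?_⟩
    rw [hν, withDensity_apply _ MeasurableSet.univ, Measure.restrict_univ,
      ← ofReal_integral_eq_lintegral_ofReal hdi (Filter.Eventually.of_forall hd0),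
      integral_Icc_eq_integral_Ioc, ← intervalIntegral.integral_of_le hl.le,
      intervalIntegral.integral_const_mul, integral_sin_sq_mul_div hl]
    have : 2 / l * (l / 2) = 1 := by field_simp
    rw [this, ENNReal.ofReal_one]
  -- The factor (2/l)^(1/p) is the cost of replacing ν by (2/l) μ in the L^p norm; it equals 1 for p
  -- = ∞.
  have hle : ν ≤ ENNReal.ofReal (2 / l) • μ := by
    rw [hν, ← withDensity_const]
    exact withDensity_mono (Filter.Eventually.of_forall fun t => ENNReal.ofReal_le_ofReal (hd1 t))
  set r : ℝ → ℝ := fun t => max (q t) 0 with hr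
  have hrm : MemLp r p μ := hq.pos_part
  have hν0 : ENNReal.ofReal (2 / l) ≠ 0 := by
    simpa using by positivity
  have hbound : eLpNorm r p ν ≤ ENNReal.ofReal (2 / l) ^ (1 / p).toReal * eLpNorm r p μ := by
    refine (eLpNorm_mono_measure r hle).trans ?_
    rw [eLpNorm_smul_measure_of_ne_zero hν0, smul_eq_mul]
  have hrν : AEStronglyMeasurable r ν :=
    hrm.aestronglyMeasurable.mono_ac (withDensity_absolutelyContinuous _ _)
  have hfin : ENNReal.ofReal (2 / l) ^ (1 / p).toReal * eLpNorm r p μ ≠ ∞ :=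
    ENNReal.mul_ne_top (ENNReal.rpow_ne_top_of_nonneg ENNReal.toReal_nonneg ENNReal.ofReal_ne_top)
      hrm.eLpNorm_ne_top
  have h1 : ∫ t, r t ∂ν ≤ (2 / l) ^ (1 / p).toReal * (eLpNorm r p μ).toReal := by
    have h2 : ∫ t, r t ∂ν = (eLpNorm r 1 ν).toReal := by
      rw [integral_eq_lintegral_of_nonneg_ae (f := r)
        (Filter.Eventually.of_forall fun t => le_max_right _ _) hrν,
        eLpNorm_one_eq_lintegral_enorm]
      congr 1
      refine lintegral_congr fun t => ?_
      rw [Real.enorm_eq_ofReal (le_max_right _ _)]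
    have h3 : (2 / l) ^ (1 / p).toReal * (eLpNorm r p μ).toReal =
        (ENNReal.ofReal (2 / l) ^ (1 / p).toReal * eLpNorm r p μ).toReal := by
      rw [ENNReal.toReal_mul, ← ENNReal.toReal_rpow, ENNReal.toReal_ofReal (by positivity)]
    rw [h2, h3]
    exact ENNReal.toReal_mono hfin
      ((eLpNorm_le_eLpNorm_of_exponent_le hp hrν).trans hbound)
  refine le_trans ?_ h1
  rw [hν, integral_withDensity_eq_integral_toReal_smul (by fun_prop)
    (Filter.Eventually.of_forall fun _ => ENNReal.ofReal_lt_top),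
    ← intervalIntegral.integral_const_mul, intervalIntegral.integral_of_le hl.le,
    ← integral_Icc_eq_integral_Ioc]
  have hqi : Integrable q μ := hq.integrable hp
  have hdb : ∀ t, ‖d t‖ ≤ 2 / l := fun t => by
    rw [Real.norm_of_nonneg (hd0 t)]; exact hd1 t
  have e1 : (fun t => 2 / l * (q t * Real.sin (Real.pi / l * t) ^ 2)) = fun t => d t * q t := by
    ext t; simp only [hd]; ring
  rw [e1]
  simp only [ENNReal.toReal_ofReal (hd0 _), smul_eq_mul]
  refine integral_mono (hqi.bdd_mul hdc.aestronglyMeasurable (Filter.Eventually.of_forall hdb))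
    ((hrm.integrable hp).bdd_mul hdc.aestronglyMeasurable (Filter.Eventually.of_forall hdb))
    fun t => ?_
  exact mul_le_mul_of_nonneg_left (le_max_left _ _) (hd0 t)

/-! ### The trial function and the bound through one edge. -/

namespace MetricGraph

variable {V E : Type*}

section

variable [Fintype V] [Fintype E] (Γ : MetricGraph V E) (α : V → WithTop ℝ)

/-- The half-period sine on one edge lies in the form domain. -/
theorem exists_sine_mem_energySpace {q : E → ℝ → ℝ}
    (hq : ∀ e a b, IntervalIntegrable (q e) volume a b) (e : E) :
    ∃ z ∈ Γ.energySpace α, Γ.edgeFunction e z ≠ 0 ∧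
      Γ.massForm (fun e => Γ.edgeFunction e z) (fun e => Γ.edgeFunction e z) = Γ.len e / 2 ∧
      Γ.energyForm α q hq z z = (Real.pi / Γ.len e) ^ 2 * (Γ.len e / 2) +
        ∫ t in 0..Γ.len e, q e t * Real.sin (Real.pi / Γ.len e * t) ^ 2 := by
  classical
  set l := Γ.len e with hl
  have hl0 : 0 < l := Γ.len_pos e
  set k : ℝ → ℝ := fun t => Real.pi / l * Real.cos (Real.pi / l * t) with hk
  have hkm : MemLp k 2 (volume.restrict (Ioc 0 l)) := by
    refine MemLp.of_bound (by fun_prop) (Real.pi / l) (Filter.Eventually.of_forall fun t => ?_)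
    rw [hk, norm_mul, Real.norm_of_nonneg (by positivity)]
    exact mul_le_of_le_one_right (by positivity) (Real.abs_cos_le_one _)
  have hprim : ∀ x ∈ Icc 0 l, ∫ t in 0..x, hkm.toLp k t = Real.sin (Real.pi / l * x) := by
    intro x hx
    rw [IntervalL2.intervalIntegral_congr_ae hkm.coeFn_toLp hx,
      intervalIntegral.integral_eq_sub_of_hasDerivAt (f := fun t => Real.sin (Real.pi / l * t))]
    · simp
    · intro t _
      have := ((hasDerivAt_id t).const_mul (Real.pi / l)).sin
      simpa [hk, mul_comm] using this
    · exact Continuous.intervalIntegrable (by fun_prop) _ _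
  -- All vertex values are zero, which removes every condition and term involving α.
  set z : Γ.VertexEdgeData := (0, Pi.single e (hkm.toLp k)) with hz
  have hze : z.2 e = hkm.toLp k := Pi.single_eq_same (M := fun e => IntervalL2 (Γ.len e)) e _
  have hze' : ∀ e', e' ≠ e → z.2 e' = 0 := fun e' h => Pi.single_eq_of_ne h _
  have hfe' : ∀ e', e' ≠ e → Γ.edgeFunction e' z = 0 := fun e' h => by
    rw [edgeFunction_eq, hze' e' h]
    exact map_zero _
  have hfe : ∀ t ∈ Icc 0 l, IccExtend (Γ.len_nonneg e) (Γ.edgeFunction e z) t =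
      Real.sin (Real.pi / l * t) := fun t ht => by
    rw [Γ.edgeFunction_extend e z ht, hze, hprim t ht]
    exact zero_add _
  have hsq : ∀ (r : ℝ → ℝ) (hr : ∀ a b, IntervalIntegrable r volume a b),
      IntervalL2.weightedIntegral (Γ.len_nonneg e) r hr
        (Γ.edgeFunction e z * Γ.edgeFunction e z) =
      ∫ t in 0..l, r t * Real.sin (Real.pi / l * t) ^ 2 := fun r hr => by
    rw [IntervalL2.weightedIntegral_apply]
    refine intervalIntegral.integral_congr fun t ht => ?_
    rw [uIcc_of_le hl0.le] at ht
    simp only [← hfe t ht, IccExtend, Function.comp_apply, ContinuousMap.mul_apply, sq]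
  refine ⟨z, mem_energySpace.2 ⟨fun e' => ?_, fun _ _ => rfl⟩, fun h => ?_, ?_, ?_⟩
  · have hI := right_mem_Icc.2 (Γ.len_nonneg e')
    rw [← Γ.edgeFunction_extend e' z hI]
    rcases eq_or_ne e' e with rfl | h
    · rw [hfe l hI, div_mul_cancel₀ _ hl0.ne', Real.sin_pi]
      rfl
    · rw [hfe' e' h]
      rfl
  · have h1 := hfe (l / 2) ⟨by positivity, by linarith⟩
    rw [h, show Real.pi / l * (l / 2) = Real.pi / 2 by field_simp, Real.sin_pi_div_two] at h1
    exact zero_ne_one h1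
  · rw [massForm_apply, Finset.sum_eq_single e (fun e' _ h => by simp [hfe' e' h]) (by simp), hsq]
    simp only [one_mul]
    exact integral_sin_sq_mul_div hl0
  · rw [energyForm_apply, Finset.sum_eq_single e (fun e' _ h => by simp [hze' e' h]) (by simp),
      Finset.sum_eq_single e (fun e' _ h => by simp [hfe' e' h]) (by simp), hsq, hze,
      IntervalL2.inner_eq_intervalIntegral hl0.le]
    have h1 : ∫ t in 0..l, hkm.toLp k t * hkm.toLp k t =
        (Real.pi / l) ^ 2 * (l / 2) := by
      rw [← integral_cos_sq_mul_div hl0, ← intervalIntegral.integral_const_mul]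
      refine IntervalL2.intervalIntegral_congr_ae ?_ (right_mem_Icc.2 hl0.le)
      filter_upwards [hkm.coeFn_toLp] with t ht
      rw [ht, hk]
      ring
    rw [h1]
    simp [hz]
    rfl

end

variable [Fintype E] [DecidableEq V]

/-- The potential enters only through an almost everywhere equation. It may thus be cut off outside
the edges, which makes it integrable on every interval of ℝ. -/
theorem eigenvalues_congr_ae (Γ : MetricGraph V E) {q q' : E → ℝ → ℝ} (α : V → WithTop ℝ)
    (h : ∀ e, q e =ᵐ[volume.restrict (Icc 0 (Γ.len e))] q' e) :
    Γ.eigenvalues q α = Γ.eigenvalues q' α := by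
  have key : ∀ {q q' : E → ℝ → ℝ}, (∀ e, q e =ᵐ[volume.restrict (Icc 0 (Γ.len e))] q' e) →
      Γ.eigenvalues q α ⊆ Γ.eigenvalues q' α := by
    rintro q q' h lam ⟨f, f', u, hf⟩
    refine ⟨f, f', u, { hf with eqn := fun e => ?_ }⟩
    filter_upwards [hf.eqn e, h e] with x hx hq
    rwa [← hq]
  exact (key h).antisymm (key fun e => (h e).symm)

omit [Fintype E] [DecidableEq V] in
theorem measurable_sigma_mk (e : E) : Measurable (Sigma.mk (β := fun _ : E => ℝ) e) :=
  Measurable.of_le_map (iInf_le (fun e => MeasurableSpace.map (Sigma.mk (β := fun _ : E => ℝ) e)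
    inferInstance) e)

omit [Fintype E] [DecidableEq V] in
theorem map_restrict_le_measure (Γ : MetricGraph V E) (e : E) :
    (volume.restrict (Icc 0 (Γ.len e))).map (Sigma.mk e) ≤ Γ.measure :=
  Measure.le_sum (fun e => (volume.restrict (Icc 0 (Γ.len e))).map (Sigma.mk e)) e

omit [Fintype E] [DecidableEq V] in
theorem memLp_edge (Γ : MetricGraph V E) {p : ℝ≥0∞} {r : (Σ _ : E, ℝ) → ℝ}
    (hr : MemLp r p Γ.measure) (e : E) :
    MemLp (fun t => r ⟨e, t⟩) p (volume.restrict (Icc 0 (Γ.len e))) :=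
  (hr.mono_measure (Γ.map_restrict_le_measure e)).comp_of_map (measurable_sigma_mk e).aemeasurable

omit [Fintype E] [DecidableEq V] in
theorem eLpNorm_edge_le (Γ : MetricGraph V E) {p : ℝ≥0∞} {r : (Σ _ : E, ℝ) → ℝ}
    (hr : MemLp r p Γ.measure) (e : E) :
    eLpNorm (fun t => r ⟨e, t⟩) p (volume.restrict (Icc 0 (Γ.len e))) ≤
      eLpNorm r p Γ.measure := by
  have h := eLpNorm_mono_measure (p := p) r (Γ.map_restrict_le_measure e)
  rwa [eLpNorm_map_measure (hr.mono_measure (Γ.map_restrict_le_measure e)).aestronglyMeasurable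
    (measurable_sigma_mk e).aemeasurable] at h

/-- The principal eigenvalue exists and is bounded through any single edge. -/
theorem isLeast_principalEigenvalue_and_le [Nonempty E] (Γ : MetricGraph V E) {p : ℝ≥0∞}
    (hp : 1 ≤ p) {q : E → ℝ → ℝ} (hq : MemLp (fun x : (Σ _ : E, ℝ) => q x.1 x.2) p Γ.measure)
    (α : V → WithTop ℝ) :
    IsLeast (Γ.eigenvalues q α) (Γ.principalEigenvalue q α) ∧
    ∀ e, Γ.principalEigenvalue q α ≤ (2 / Γ.len e) ^ (1 / p).toReal * Γ.posPartNorm q p +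
      (Real.pi / Γ.len e) ^ 2 := by
  have : Finite V := Γ.finite_vertices
  have : Fintype V := Fintype.ofFinite V
  set q' : E → ℝ → ℝ := fun e => (Icc 0 (Γ.len e)).indicator (q e) with hq'
  have hqe : ∀ e, MemLp (q e) p (volume.restrict (Icc 0 (Γ.len e))) := fun e => Γ.memLp_edge hq e
  have hqq' : ∀ e, q e =ᵐ[volume.restrict (Icc 0 (Γ.len e))] q' e := fun e =>
    (indicator_ae_eq_restrict measurableSet_Icc).symm
  have hq'i : ∀ e a b, IntervalIntegrable (q' e) volume a b := fun e a b =>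
    ((integrable_indicator_iff measurableSet_Icc).2 ((hqe e).integrable hp)).intervalIntegrable
  have hsin := Γ.exists_sine_mem_energySpace α hq'i
  obtain ⟨lam, z, hzX, hz0, hz, hmin⟩ := Γ.exists_minimizer α hq'i (by
    obtain ⟨e⟩ := ‹Nonempty E›
    obtain ⟨z, hz, h, -⟩ := hsin e
    exact ⟨z, hz, e, h⟩)
  have hleast : IsLeast (Γ.eigenvalues q α) lam := by
    rw [Γ.eigenvalues_congr_ae α hqq']
    refine ⟨isEigenfunction_of_weak hq'i hzX hz0 hz, fun μ hμ => ?_⟩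
    obtain ⟨w, hwX, hw0, hw⟩ := exists_energyForm_eq_of_mem_eigenvalues hq'i hμ
    have h1 := hmin w hwX
    rw [hw] at h1
    exact le_of_mul_le_mul_right h1 (Γ.massForm_pos (Function.ne_iff.2 hw0))
  have hlam : Γ.principalEigenvalue q α = lam := hleast.csInf_eq
  rw [hlam]
  refine ⟨hleast, fun e => ?_⟩
  obtain ⟨w, hwX, -, hwN, hwQ⟩ := hsin e
  have hl := Γ.len_pos e
  have h1 := hmin w hwX
  rw [hwN, hwQ] at h1
  have h2 : ∫ t in 0..Γ.len e, q' e t * Real.sin (Real.pi / Γ.len e * t) ^ 2 =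
      ∫ t in 0..Γ.len e, q e t * Real.sin (Real.pi / Γ.len e * t) ^ 2 := by
    refine intervalIntegral.integral_congr fun t ht => ?_
    rw [uIcc_of_le hl.le] at ht
    simp only [hq', indicator_of_mem ht]
  have h3 := integral_mul_sin_sq_le hl hp (hqe e)
  have h4 : (eLpNorm (fun t => max (q e t) 0) p (volume.restrict (Icc 0 (Γ.len e)))).toReal ≤
      Γ.posPartNorm q p :=
    ENNReal.toReal_mono hq.pos_part.eLpNorm_ne_top (Γ.eLpNorm_edge_le hq.pos_part e)
  have h5 : (2 / Γ.len e) ^ (1 / p).toReal *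
      (eLpNorm (fun t => max (q e t) 0) p (volume.restrict (Icc 0 (Γ.len e)))).toReal ≤
      (2 / Γ.len e) ^ (1 / p).toReal * Γ.posPartNorm q p := by gcongr
  rw [h2] at h1
  -- The sine has mass l/2, so the factor 2/l normalizes the variational inequality.
  have h6 : lam = 2 / Γ.len e * (lam * (Γ.len e / 2)) := by field_simp
  have h7 : 2 / Γ.len e * ((Real.pi / Γ.len e) ^ 2 * (Γ.len e / 2)) = (Real.pi / Γ.len e) ^ 2 := by
    field_simp
  have h8 := mul_le_mul_of_nonneg_left h1 (show 0 ≤ 2 / Γ.len e by positivity)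
  rw [← h6, mul_add, h7] at h8
  linarith

end MetricGraph

/-! ### The longest edge and its comparison with the mean length. -/

theorem mainTheorem2 {V E : Type*} [DecidableEq V] [Fintype E] [Nonempty E]
    (Γ : MetricGraph V E) (p : ℝ≥0∞) (hp : 1 ≤ p)
    (q : E → ℝ → ℝ) (hq : MemLp (fun x : (Σ _ : E, ℝ) => q x.1 x.2) p Γ.measure)
    (α : V → WithTop ℝ) :
    IsLeast (Γ.eigenvalues q α) (Γ.principalEigenvalue q α) ∧
    Γ.principalEigenvalue q α ≤
      (2 / Γ.maxLength) ^ (1 / p).toReal * Γ.posPartNorm q p + (Real.pi / Γ.maxLength) ^ 2 ∧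
    Γ.principalEigenvalue q α ≤
      (2 * (Fintype.card E : ℝ) / Γ.totalLength) ^ (1 / p).toReal * Γ.posPartNorm q p +
        (Real.pi * (Fintype.card E : ℝ) / Γ.totalLength) ^ 2 := by
  obtain ⟨h1, h2⟩ := Γ.isLeast_principalEigenvalue_and_le hp hq α
  obtain ⟨e, he⟩ := exists_eq_ciSup_of_finite (f := Γ.len)
  have he' : Γ.len e = Γ.maxLength := he
  have hmax : 0 < Γ.maxLength := he' ▸ Γ.len_pos e
  have h3 := h2 e
  rw [he'] at h3
  refine ⟨h1, h3, h3.trans ?_⟩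
  have hL : 0 < Γ.totalLength :=
    Finset.sum_pos (fun e _ => Γ.len_pos e) Finset.univ_nonempty
  have hle : Γ.totalLength ≤ Fintype.card E * Γ.maxLength := by
    have h := Finset.sum_le_card_nsmul Finset.univ Γ.len Γ.maxLength
      fun e _ => le_ciSup (Finite.bddAbove_range Γ.len) e
    rwa [nsmul_eq_mul] at h
  have key : ∀ c : ℝ, 0 ≤ c →
      c / Γ.maxLength ≤ c * (Fintype.card E : ℝ) / Γ.totalLength := fun c hc => by
    rw [div_le_div_iff₀ hmax hL, mul_assoc]
    exact mul_le_mul_of_nonneg_left hle hc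
  have hN : 0 ≤ Γ.posPartNorm q p := ENNReal.toReal_nonneg
  have k2 := key 2 zero_le_two
  have kpi := key Real.pi Real.pi_pos.le
  gcongr
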